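/- Let $\mathbb K$ be a field of characteristic $0$. **Building sets.** A building set on a finite set $V$ is a set $B$ of non-empty subsets of $V$ (its connected sets) such that $\{v\}\in B$ for all $v\in V$, and $I\cup J\in B$ whenever $I,J\in B$ and $I\cap J\neq\emptyset$. Its connected components are its maximal elements; $\mathrm{cc}(B)$ is their number. Let $\mathrm{BS}[V]$ be the $\mathbb K$-vector space with basis the building sets on $V$. The Hopf monoid $\mathrm{BS}$ has, for $V=V_1\sqcup V_2$, the product $\mu_{V_1,V_2}(B_1\otimes B_2)=B_1\sqcup B_2$ and the coproduct $\Delta_{V_1,V_2}(B)=B|_{V_1}\otimes B/_{V_1}$, where $B|_{V_1}=\{e\in B: e\subseteq V_1\}$ and $B/_{V_1}=\{e\cap V_2: e\in B,\ e\not\subseteq V_1\}$. For $V=V_1\sqcup\dots\sqcup V_n$, let $\mu_{V_1,\dots,V_n}$ and $\Delta_{V_1,\dots,V_n}$ be the iterated maps. A character $\zeta$ of $\mathrm{BS}$ is a family of linear maps $\zeta_V:\mathrm{BS}[V]\to\mathbb K$, one for each finite set $V$, compatible with the product and the unit. It is a characteristic function if $\zeta(B)\in\{0,1\}$ for every building set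 $B$. It is odd if $\zeta(B)=0$ for every building set $B$ having a connected component with an even number of vertices. For $x\in\mathrm{BS}[V]$ and $n\in\mathbb N$ put $$\chi^\zeta_V(x)(n)=\sum_{V=V_1\sqcup\dots\sqcup V_n}\zeta_V\circ\mu_{V_1,\dots,V_n}\circ\Delta_{V_1,\dots,V_n}(x),$$ the parts $V_i$ being allowed to be empty. **$B$-forests.** Let $B$ be a building set on $V$. Let $F$ be a rooted forest whose nodes are the blocks of a partition of $V$; write $q\le p$ if the node $q$ is a descendant of the node $p$ (or $q=p$), and $F_{\le p}=\bigsqcup_{q\le p}q$. Then $F$ is a $B$-forest if (1) for every root $r$, $F_{\le r}$ is a connected component of $B$; (2) $F_{\le p}\in B$ for every node $p$; (3) $\bigcup_i F_{\le p_i}\notin B$ for any $k\ge2$ pairwise incomparable nodes $p_1,\dots,p_k$. For a $B$-forest $F$, the building set $B\cap F$ on $V$ consists of the sets $e\cap p$, where $e\in B$ and $p$ is the maximum among the nodes of $F$ that meet $e$. A $\zeta$-$B$-forest is a $B$-forest $F$ with $\zeta(B\cap F)\ne0$. A coloring $c:V\to[n]=\{1,\dots,n\}$ is compatible (resp. strictly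 compatible) with $F$ if it is constant on every node and, for nodes $q<p$, $c(q)\le c(p)$ (resp. $c(q)<c(p)$). **Proposition.** Let $\zeta$ be a character of $\mathrm{BS}$, $V$ a finite set and $B$ a building set on $V$. Then $n\mapsto\chi^\zeta_V(B)(n)$ is given by a polynomial, also denoted $\chi^\zeta_V(B)$, and for all integers $n\ge0$ $$\chi^\zeta_V(B)(n)=\sum_{F}\zeta(B\cap F)\cdot\#\{c:V\to[n]\text{ strictly compatible with }F\},$$ $$\chi^\zeta_V(B)(-n)=\sum_{F}(-1)^{\mathrm{cc}(B\cap F)}\zeta(B\cap F)\cdot\#\{c:V\to[n]\text{ compatible with }F\},$$ where $F$ runs over all $B$-forests. If $\zeta$ is a characteristic function, then $\chi^\zeta_V(B)(n)$ is the number of pairs $(F,c)$ of a $\zeta$-$B$-forest $F$ and a coloring $c:V\to[n]$ strictly compatible with it. If $\zeta$ is moreover odd, then $(-1)^{|V|}\chi^\zeta_V(B)(-n)$ is the number of pairs $(F,c)$ of a $\zeta$-$B$-forest $F$ and a coloring $c:V\to[n]$ compatible with it; in particular $(-1)^{|V|}\chi^\zeta_V(B)(-1)$ is the number of $\zeta$-$B$-forests.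 -/

import Mathlib

open scoped TensorProduct

universe u v

/-! ## Building sets

Finite sets are the finite subsets `V : Finset α` of an arbitrary type `α`. -/

/-- `V = V₁ ⊔ V₂` (disjoint union). -/
def IsDisjUnion {α : Type u} [DecidableEq α] (V₁ V₂ V : Finset α) : Prop :=
  Disjoint V₁ V₂ ∧ V₁ ∪ V₂ = V

/-- A building set on `V`: a collection of non-empty subsets of `V` (the connected sets) that
contains all singletons and is stable under the union of two intersecting members. -/
@[ext]
structure BuildingSet {α : Type u} [DecidableEq α] (V : Finset α) where
  sets : Finset (Finset α)
  subset_ground : ∀ e ∈ sets, e ⊆ V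
  nonempty_of_mem : ∀ e ∈ sets, e.Nonempty
  singleton_mem : ∀ v ∈ V, {v} ∈ sets
  union_mem : ∀ e ∈ sets, ∀ e' ∈ sets, (e ∩ e').Nonempty → e ∪ e' ∈ sets

namespace BuildingSet

variable {α : Type u} [DecidableEq α]

/-- The connected components of a building set: its maximal connected sets. -/
noncomputable def components {V : Finset α} (B : BuildingSet V) : Finset (Finset α) :=
  open Classical in B.sets.filter fun e => ∀ e' ∈ B.sets, e ⊆ e' → e' = e

/-- The number of connected components. -/
noncomputable def cc {V : Finset α} (B : BuildingSet V) : ℕ := B.components.card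

/-- The unique building set on the empty set. -/
def empty : BuildingSet (∅ : Finset α) where
  sets := ∅
  subset_ground := by simp
  nonempty_of_mem := by simp
  singleton_mem := by simp
  union_mem := by simp

/-- The disjoint union of a building set on `V₁` and a building set on `V₂`. -/
def disjUnion {V₁ V₂ V : Finset α} (h : IsDisjUnion V₁ V₂ V)
    (B₁ : BuildingSet V₁) (B₂ : BuildingSet V₂) : BuildingSet V where
  sets := B₁.sets ∪ B₂.sets
  subset_ground := by
    intro e he
    rw [← h.2]
    rcases Finset.mem_union.1 he with he | he
    · exact (B₁.subset_ground e he).trans Finset.subset_union_left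
    · exact (B₂.subset_ground e he).trans Finset.subset_union_right
  nonempty_of_mem := by
    intro e he
    rcases Finset.mem_union.1 he with he | he
    · exact B₁.nonempty_of_mem e he
    · exact B₂.nonempty_of_mem e he
  singleton_mem := by
    intro v hv
    rw [← h.2] at hv
    rcases Finset.mem_union.1 hv with hv | hv
    · exact Finset.mem_union_left _ (B₁.singleton_mem v hv)
    · exact Finset.mem_union_right _ (B₂.singleton_mem v hv)
  union_mem := by
    intro e he e' he' hne
    obtain ⟨x, hx⟩ := hne
    rw [Finset.mem_inter] at hx
    rcases Finset.mem_union.1 he with he | he <;> rcases Finset.mem_union.1 he' with he' | he'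
    · exact Finset.mem_union_left _
        (B₁.union_mem e he e' he' ⟨x, Finset.mem_inter.2 hx⟩)
    · exact absurd (B₂.subset_ground e' he' hx.2)
        (Finset.disjoint_left.1 h.1 (B₁.subset_ground e he hx.1))
    · exact absurd (B₂.subset_ground e he hx.1)
        (Finset.disjoint_left.1 h.1 (B₁.subset_ground e' he' hx.2))
    · exact Finset.mem_union_right _
        (B₂.union_mem e he e' he' ⟨x, Finset.mem_inter.2 hx⟩)

/-- The restriction `B|_S = {e ∈ B | e ⊆ S}`. -/
def restrict {V : Finset α} (S : Finset α) (hS : S ⊆ V) (B : BuildingSet V) : BuildingSet S where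
  sets := B.sets.filter (· ⊆ S)
  subset_ground := fun e he => (Finset.mem_filter.1 he).2
  nonempty_of_mem := fun e he => B.nonempty_of_mem e (Finset.mem_filter.1 he).1
  singleton_mem := fun v hv =>
    Finset.mem_filter.2 ⟨B.singleton_mem v (hS hv), Finset.singleton_subset_iff.2 hv⟩
  union_mem := by
    intro e he e' he' hne
    rw [Finset.mem_filter] at he he' ⊢
    exact ⟨B.union_mem e he.1 e' he'.1 hne, Finset.union_subset he.2 he'.2⟩

/-- The contraction `B/_{V₁} = {e ∩ V₂ | e ∈ B, e ⊄ V₁}`, where `V = V₁ ⊔ V₂`. -/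
def contract {V₁ V₂ V : Finset α} (h : IsDisjUnion V₁ V₂ V) (B : BuildingSet V) :
    BuildingSet V₂ where
  sets := (B.sets.filter fun e => ¬ e ⊆ V₁).image (· ∩ V₂)
  subset_ground := by
    intro e he
    obtain ⟨a, -, rfl⟩ := Finset.mem_image.1 he
    exact Finset.inter_subset_right
  nonempty_of_mem := by
    intro e he
    obtain ⟨a, ha, rfl⟩ := Finset.mem_image.1 he
    rw [Finset.mem_filter] at ha
    obtain ⟨x, hxa, hx⟩ := Finset.not_subset.1 ha.2
    have hxV := B.subset_ground a ha.1 hxa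
    rw [← h.2] at hxV
    exact ⟨x, Finset.mem_inter.2 ⟨hxa, (Finset.mem_union.1 hxV).resolve_left hx⟩⟩
  singleton_mem := by
    intro v hv
    have hvV : v ∈ V := h.2 ▸ Finset.mem_union_right _ hv
    refine Finset.mem_image.2 ⟨{v}, Finset.mem_filter.2 ⟨B.singleton_mem v hvV, ?_⟩, ?_⟩
    · rw [Finset.singleton_subset_iff]
      exact fun hv' => Finset.disjoint_left.1 h.1 hv' hv
    · exact Finset.inter_eq_left.2 (Finset.singleton_subset_iff.2 hv)
  union_mem := by
    intro e he e' he' hne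
    obtain ⟨a, ha, rfl⟩ := Finset.mem_image.1 he
    obtain ⟨b, hb, rfl⟩ := Finset.mem_image.1 he'
    rw [Finset.mem_filter] at ha hb
    obtain ⟨x, hx⟩ := hne
    simp only [Finset.mem_inter] at hx
    refine Finset.mem_image.2 ⟨a ∪ b, Finset.mem_filter.2
      ⟨B.union_mem a ha.1 b hb.1 ⟨x, Finset.mem_inter.2 ⟨hx.1.1, hx.2.1⟩⟩, ?_⟩, ?_⟩
    · exact fun hs => ha.2 (Finset.subset_union_left.trans hs)
    · exact Finset.union_inter_distrib_right a b V₂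

end BuildingSet

/-! ## The Hopf monoid of building sets -/

/-- The vector space `BS[V]` spanned by the building sets on `V`. -/
abbrev BS (K : Type v) [Field K] {α : Type u} [DecidableEq α] (V : Finset α) : Type (max u v) :=
  BuildingSet V →₀ K

namespace BS

variable (K : Type v) [Field K] {α : Type u} [DecidableEq α]

/-- The product `μ_{V₁,V₂} : BS[V₁] ⊗ BS[V₂] → BS[V]`, `B₁ ⊗ B₂ ↦ B₁ ⊔ B₂`. -/
noncomputable def mul {V₁ V₂ V : Finset α} (h : IsDisjUnion V₁ V₂ V) :
    BS K V₁ ⊗[K] BS K V₂ →ₗ[K] BS K V :=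
  Finsupp.lmapDomain K K (fun p : BuildingSet V₁ × BuildingSet V₂ => p.1.disjUnion h p.2) ∘ₗ
    (finsuppTensorFinsupp' K (BuildingSet V₁) (BuildingSet V₂)).toLinearMap

/-- The coproduct `Δ_{V₁,V₂} : BS[V] → BS[V₁] ⊗ BS[V₂]`, `B ↦ B|_{V₁} ⊗ B/_{V₁}`. -/
noncomputable def comul {V₁ V₂ V : Finset α} (h : IsDisjUnion V₁ V₂ V) :
    BS K V →ₗ[K] BS K V₁ ⊗[K] BS K V₂ :=
  (finsuppTensorFinsupp' K (BuildingSet V₁) (BuildingSet V₂)).symm.toLinearMap ∘ₗ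
    Finsupp.lmapDomain K K (fun B : BuildingSet V =>
      (B.restrict V₁ (h.2 ▸ Finset.subset_union_left), B.contract h))

/-- The unit, an element of the one-dimensional space `BS[∅]`. -/
noncomputable def one : BS K (∅ : Finset α) := Finsupp.single BuildingSet.empty 1

end BS

/-- A decomposition `V = V₁ ⊔ ⋯ ⊔ V_n` into `n` possibly empty parts (indexed from `0`). -/
@[ext]
structure Decomposition {α : Type u} [DecidableEq α] (V : Finset α) (n : ℕ) where
  part : Fin n → Finset α
  disjoint : ∀ i j, i ≠ j → Disjoint (part i) (part j)
  union_eq : Finset.univ.biUnion part = V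

namespace Decomposition

variable {α : Type u} [DecidableEq α]

theorem part_subset {V : Finset α} {n : ℕ} (D : Decomposition V n) (i : Fin n) : D.part i ⊆ V := by
  exact (Finset.subset_biUnion_of_mem D.part (Finset.mem_univ i)).trans D.union_eq.subset

noncomputable instance {V : Finset α} {n : ℕ} : Fintype (Decomposition V n) :=
  open Classical in
  Fintype.ofInjective
    (fun D : Decomposition V n => fun i => (⟨D.part i, Finset.mem_powerset.2 (D.part_subset i)⟩ :
      {S // S ∈ V.powerset}))
    (fun _ _ h => Decomposition.ext (funext fun i => congrArg Subtype.val (congrFun h i)))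

theorem isDisjUnion {V : Finset α} {n : ℕ} (D : Decomposition V (n + 1)) :
    IsDisjUnion (D.part 0) (V \ D.part 0) V :=
  ⟨Finset.disjoint_sdiff, Finset.union_sdiff_of_subset (D.part_subset 0)⟩

/-- The decomposition `(V₂, …, V_{n+1})` of `V ∖ V₁`. -/
def tail {V : Finset α} {n : ℕ} (D : Decomposition V (n + 1)) :
    Decomposition (V \ D.part 0) n where
  part := Fin.tail D.part
  disjoint := fun i j hij => D.disjoint i.succ j.succ fun h => hij (Fin.succ_injective n h)
  union_eq := by
    ext x
    have hV : x ∈ V ↔ ∃ i, x ∈ D.part i := by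
      conv_lhs => rw [← D.union_eq]
      simp
    simp only [Finset.mem_biUnion, Finset.mem_univ, true_and, Finset.mem_sdiff, Fin.tail, hV]
    constructor
    · rintro ⟨i, hi⟩
      exact ⟨⟨i.succ, hi⟩, fun h0 =>
        Finset.disjoint_left.1 (D.disjoint 0 i.succ (Fin.succ_ne_zero i).symm) h0 hi⟩
    · rintro ⟨⟨i, hi⟩, h0⟩
      refine Fin.cases (fun h => absurd h h0) (fun j hj => ⟨j, hj⟩) i hi

theorem eq_empty {V : Finset α} (D : Decomposition V 0) : V = ∅ := by
  rw [← D.union_eq]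
  simp

end Decomposition

namespace BS

variable (K : Type v) [Field K] {α : Type u} [DecidableEq α]

/-- The iterated tensor product `BS[V₁] ⊗ (BS[V₂] ⊗ (⋯ ⊗ (BS[V_n] ⊗ BS[∅])))`, where the factor
`BS[∅]` is the one-dimensional space spanned by the unit. -/
noncomputable def iterTensor : {V : Finset α} → (n : ℕ) → Decomposition V n → ModuleCat.{max u v} K
  | _, 0, _ => ModuleCat.of K (BS K (∅ : Finset α))
  | _, n + 1, D => ModuleCat.of K (BS K (D.part 0) ⊗[K] iterTensor n D.tail)

/-- The iterated product `μ_{V₁,…,V_n}`. -/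
noncomputable def iterMul : {V : Finset α} → (n : ℕ) → (D : Decomposition V n) →
    (iterTensor K n D →ₗ[K] BS K V)
  | _, 0, D => Finsupp.lmapDomain K K fun B : BuildingSet (∅ : Finset α) =>
      B.restrict _ D.eq_empty.subset
  | _, n + 1, D => mul K D.isDisjUnion ∘ₗ TensorProduct.map LinearMap.id (iterMul n D.tail)

/-- The iterated coproduct `Δ_{V₁,…,V_n}`. -/
noncomputable def iterComul : {V : Finset α} → (n : ℕ) → (D : Decomposition V n) →
    (BS K V →ₗ[K] iterTensor K n D)
  | _, 0, _ => Finsupp.lmapDomain K K fun B => B.restrict ∅ (Finset.empty_subset _)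
  | _, n + 1, D => TensorProduct.map LinearMap.id (iterComul n D.tail) ∘ₗ comul K D.isDisjUnion

end BS

/-- A character of the Hopf monoid of building sets: a family of linear maps `ζ_V : BS[V] → K`,
one for every finite set `V`, compatible with the product and the unit. -/
structure BSCharacter (K : Type v) [Field K] (α : Type u) [DecidableEq α] where
  toLin : (V : Finset α) → BS K V →ₗ[K] K
  map_mul : ∀ (V₁ V₂ V : Finset α) (h : IsDisjUnion V₁ V₂ V) (x : BS K V₁) (y : BS K V₂),
    toLin V (BS.mul K h (x ⊗ₜ[K] y)) = toLin V₁ x * toLin V₂ y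
  map_one : toLin ∅ (BS.one K) = 1

namespace BSCharacter

variable {K : Type v} [Field K] {α : Type u} [DecidableEq α]

/-- The value `ζ(B)` on a building set `B`. -/
noncomputable def val (ζ : BSCharacter K α) {V : Finset α} (B : BuildingSet V) : K :=
  ζ.toLin V (Finsupp.single B 1)

/-- `ζ` is a characteristic function: its values on building sets are `0` and `1`. -/
def IsCharacteristic (ζ : BSCharacter K α) : Prop :=
  ∀ (V : Finset α) (B : BuildingSet V), ζ.val B = 0 ∨ ζ.val B = 1

/-- `ζ` is odd: it vanishes on every building set that has a connected component with an even
number of vertices. -/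
def IsOdd (ζ : BSCharacter K α) : Prop :=
  ∀ (V : Finset α) (B : BuildingSet V), (∃ e ∈ B.components, Even e.card) → ζ.val B = 0

/-- `χ^ζ_V(x)(n) = ∑_{V = V₁ ⊔ ⋯ ⊔ V_n} ζ_V (μ_{V₁,…,V_n} (Δ_{V₁,…,V_n} x))`. -/
noncomputable def chi (ζ : BSCharacter K α) (V : Finset α) (x : BS K V) (n : ℕ) : K :=
  ∑ D : Decomposition V n, ζ.toLin V (BS.iterMul K n D (BS.iterComul K n D x))

end BSCharacter

/-! ## Rooted forests -/

/-- A rooted forest whose vertices (nodes) are the blocks of a partition of `V`, given by its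
relation `le p q`, "`p` is a descendant of `q`" (every node being a descendant of itself).
These relations are exactly the partial orders in which the elements above any given element,
here the ancestors of a node, form a chain. -/
structure RootedForest {α : Type u} [DecidableEq α] (V : Finset α) where
  nodes : Finpartition V
  le : {p // p ∈ nodes.parts} → {p // p ∈ nodes.parts} → Prop
  le_refl : ∀ p, le p p
  le_trans : ∀ p q r, le p q → le q r → le p r
  le_antisymm : ∀ p q, le p q → le q p → p = q
  chain : ∀ p q r, le p q → le p r → le q r ∨ le r q

namespace RootedForest

variable {α : Type u} [DecidableEq α] {V : Finset α}

/-- The type of nodes. -/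
abbrev Node (F : RootedForest V) : Type u := {p // p ∈ F.nodes.parts}

/-- A root: a node without other ancestors. -/
def IsRoot (F : RootedForest V) (r : F.Node) : Prop := ∀ q, F.le r q → q = r

/-- `F_{≤ p}`, the union of all descendants of `p`. -/
noncomputable def below (F : RootedForest V) (p : F.Node) : Finset α :=
  open Classical in (Finset.univ.filter fun q : F.Node => F.le q p).biUnion Subtype.val

noncomputable instance : Fintype (RootedForest V) :=
  open Classical in
  Fintype.ofInjective
    (fun F : RootedForest V =>
      (⟨F.nodes, F.le⟩ : (π : Finpartition V) × ({p // p ∈ π.parts} → {p // p ∈ π.parts} → Prop)))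
    (by
      rintro ⟨π, l, _, _, _, _⟩ ⟨π', l', _, _, _, _⟩ h
      simp only [Sigma.mk.injEq] at h
      obtain ⟨rfl, h⟩ := h
      obtain rfl := eq_of_heq h
      rfl)

/-- The coloring `c` of `V` is strictly compatible with `F`: it is a strictly increasing map on
`F`, that is, it is constant on each node and strictly increasing from descendants to ancestors. -/
def StrictlyCompatible (F : RootedForest V) {n : ℕ} (c : {v // v ∈ V} → Fin n) : Prop :=
  (∀ (p : F.Node) (v w : {v // v ∈ V}), v.1 ∈ p.1 → w.1 ∈ p.1 → c v = c w) ∧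
  ∀ p q : F.Node, F.le p q → p ≠ q →
    ∀ v w : {v // v ∈ V}, v.1 ∈ p.1 → w.1 ∈ q.1 → c v < c w

/-- The coloring `c` of `V` is compatible with `F`: it is a weakly increasing map on `F`. -/
def Compatible (F : RootedForest V) {n : ℕ} (c : {v // v ∈ V} → Fin n) : Prop :=
  (∀ (p : F.Node) (v w : {v // v ∈ V}), v.1 ∈ p.1 → w.1 ∈ p.1 → c v = c w) ∧
  ∀ p q : F.Node, F.le p q → p ≠ q →
    ∀ v w : {v // v ∈ V}, v.1 ∈ p.1 → w.1 ∈ q.1 → c v ≤ c w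

end RootedForest

/-- `F` is a `B`-forest. -/
structure IsBForest {α : Type u} [DecidableEq α] {V : Finset α} (B : BuildingSet V)
    (F : RootedForest V) : Prop where
  /-- for a root `r`, `F_{≤ r}` is the vertex set of a connected component of `B` -/
  root : ∀ r : F.Node, F.IsRoot r → F.below r ∈ B.components
  node : ∀ p : F.Node, F.below p ∈ B.sets
  incomparable : ∀ s : Finset F.Node, 2 ≤ s.card →
    (∀ p ∈ s, ∀ q ∈ s, p ≠ q → ¬ F.le p q) → s.biUnion F.below ∉ B.sets

/-- The type of `B`-forests. -/
def BForest {α : Type u} [DecidableEq α] {V : Finset α} (B : BuildingSet V) : Type u :=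
  {F : RootedForest V // IsBForest B F}

noncomputable instance {α : Type u} [DecidableEq α] {V : Finset α} (B : BuildingSet V) :
    Fintype (BForest B) :=
  open Classical in inferInstanceAs (Fintype {F : RootedForest V // IsBForest B F})

open Classical in
/-- The `F`-induced building set `B ∩ F`: its connected sets are the `e ∩ p`, where `e ∈ B` and
`p` is the maximum among the nodes of `F` that meet `e`. -/
noncomputable def BuildingSet.induced {α : Type u} [DecidableEq α] {V : Finset α}
    (B : BuildingSet V) (F : RootedForest V) : BuildingSet V where
  sets := V.powerset.filter fun s =>
    ∃ e ∈ B.sets, ∃ p : F.Node, (e ∩ p.1).Nonempty ∧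
      (∀ q : F.Node, (e ∩ q.1).Nonempty → F.le q p) ∧ s = e ∩ p.1
  subset_ground := fun s hs => Finset.mem_powerset.1 (Finset.mem_filter.1 hs).1
  nonempty_of_mem := by
    intro s hs
    obtain ⟨-, e, -, p, hne, -, rfl⟩ := Finset.mem_filter.1 hs
    exact hne
  singleton_mem := by
    intro v hv
    obtain ⟨p, hp, hvp⟩ := F.nodes.exists_mem hv
    have hvp' : ({v} : Finset α) ∩ p = {v} :=
      Finset.inter_eq_left.2 (Finset.singleton_subset_iff.2 hvp)
    refine Finset.mem_filter.2 ⟨Finset.mem_powerset.2 (Finset.singleton_subset_iff.2 hv),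
      {v}, B.singleton_mem v hv, ⟨p, hp⟩, ?_, ?_, ?_⟩
    · rw [hvp']
      exact Finset.singleton_nonempty v
    · rintro ⟨q, hq⟩ ⟨x, hx⟩
      rw [Finset.mem_inter, Finset.mem_singleton] at hx
      obtain ⟨rfl, hxq⟩ := hx
      obtain rfl := F.nodes.eq_of_mem_parts hq hp hxq hvp
      exact F.le_refl _
    · exact hvp'.symm
  union_mem := by
    intro s hs s' hs' hne
    obtain ⟨hsV, e, he, ⟨p, hp⟩, hep, hmax, rfl⟩ := Finset.mem_filter.1 hs
    obtain ⟨hsV', e', he', ⟨p', hp'⟩, -, hmax', rfl⟩ := Finset.mem_filter.1 hs'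
    obtain ⟨x, hx⟩ := hne
    simp only [Finset.mem_inter] at hx
    obtain rfl := F.nodes.eq_of_mem_parts hp hp' hx.1.2 hx.2.2
    refine Finset.mem_filter.2 ⟨Finset.mem_powerset.2 (Finset.union_subset
      (Finset.mem_powerset.1 hsV) (Finset.mem_powerset.1 hsV')), e ∪ e',
      B.union_mem e he e' he' ⟨x, Finset.mem_inter.2 ⟨hx.1.1, hx.2.1⟩⟩, ⟨p, hp⟩, ?_, ?_, ?_⟩
    · exact hep.mono (Finset.inter_subset_inter_right Finset.subset_union_left)
    · rintro q ⟨y, hy⟩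
      rw [Finset.mem_inter, Finset.mem_union] at hy
      rcases hy.1 with h | h
      · exact hmax q ⟨y, Finset.mem_inter.2 ⟨h, hy.2⟩⟩
      · exact hmax' q ⟨y, Finset.mem_inter.2 ⟨h, hy.2⟩⟩
    · exact (Finset.union_inter_distrib_right e e' p).symm

/-! ## Order polynomials of finite posets -/

namespace OrderPolynomial

open Polynomial

/-! A decomposition of `V` into `n` parts is a coloring `c : V → [n]`, and `μ ∘ Δ` along it sends
`B` to the building set of all `e ∩ V_i`, where `e ∈ B` and `i` is the largest color on `e`
(`mem_split`). So `χ(n)` is a sum of values of `ζ` over colorings, and the point is to group the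
colorings by `B`-forest.

For a vertex `v`, let the cluster of `v` be the largest connected set containing `v` on which no
color exceeds `c v`. Clusters are pairwise nested or disjoint, hence they form a rooted forest. It
is a `B`-forest strictly compatible with `c` (`isBForest_clusterForest`,
`strictlyCompatible_clusterForest`), and the only one (`eq_clusterForest`), because strict
compatibility forces each `F_{≤ p}` to be a cluster. For this forest the split building set is `B ∩
F` (`induced_eq_split`). This yields the formula at `n ≥ 0`.

For fixed `F`, the strictly compatible colorings are the strictly increasing maps from the poset of
nodes to `[n]`. Stanley reciprocity makes their number a polynomial whose value at `-n` is, up to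
the sign `(-1)^{#nodes}`, the number of weakly increasing maps. The nodes are the connected
components of `B ∩ F` (`components_induced`), so this sign is `(-1)^{cc(B ∩ F)}`. When `ζ` is odd,
only forests with all nodes of odd size contribute, and for them the sign is `(-1)^{|V|}`. -/

theorem exists_discrete_antiderivative (p : ℚ[X]) (a : ℚ) :
    ∃ q : ℚ[X], q.eval 0 = a ∧ ∀ x : ℚ, q.eval (x + 1) = q.eval x + p.eval x := by
  suffices h : ∃ q : ℚ[X], ∀ x : ℚ, q.eval (x + 1) = q.eval x + p.eval x by
    obtain ⟨q, hq⟩ := h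
    refine ⟨q + C (a - q.eval 0), by simp, fun x => ?_⟩
    simp only [eval_add, eval_C, hq]
    ring
  induction p using Polynomial.induction_on' with
  | add p q hp hq =>
    obtain ⟨p', hp'⟩ := hp
    obtain ⟨q', hq'⟩ := hq
    refine ⟨p' + q', fun x => ?_⟩
    simp only [eval_add, hp', hq']
    ring
  | monomial n b =>
    -- Bernoulli polynomials satisfy `B_{n+1}(x + 1) - B_{n+1}(x) = (n + 1) x ^ n`.
    refine ⟨C (b / (n + 1)) * Polynomial.bernoulli (n + 1), fun x => ?_⟩
    have h := Polynomial.bernoulli_eval_one_add (n + 1) x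
    have hn : (n : ℚ) + 1 ≠ 0 := by positivity
    rw [add_comm x 1, eval_mul, h, eval_mul, eval_monomial]
    simp only [eval_C, Nat.add_sub_cancel]
    push_cast
    field_simp

variable {P : Type u} [PartialOrder P]

/-- Strictly increasing maps to `[n + 1]` whose top fibre is `A` are strictly increasing maps
from the complement of `A` to `[n]`. -/
def strictFiberEquiv (n : ℕ) (A : Finset P) [DecidablePred (· ∈ A)] (hA : ∀ a ∈ A, IsMax a) :
    {c : P → Fin (n + 1) // StrictMono c ∧ ∀ x, x ∈ A ↔ c x = Fin.last n} ≃
      {c : {x // x ∉ A} → Fin n // StrictMono c} where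
  toFun c := ⟨fun x => (c.1 x.1).castPred fun h => x.2 ((c.2.2 x.1).2 h), fun x y hxy =>
    Fin.castPred_lt_castPred_iff.2 (c.2.1 hxy)⟩
  invFun c := ⟨fun x => if h : x ∈ A then Fin.last n else (c.1 ⟨x, h⟩).castSucc, by
    refine ⟨fun x y hxy => ?_, fun x => ?_⟩
    · have hx : x ∉ A := fun h => (hA x h).not_lt hxy
      by_cases hy : y ∈ A
      · simp [hx, hy, Fin.castSucc_lt_last]
      · simp only [hx, hy, dite_false, Fin.castSucc_lt_castSucc_iff]
        exact c.2 hxy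
    · by_cases hx : x ∈ A
      · simp [hx]
      · simp [hx, (Fin.castSucc_lt_last _).ne]⟩
  left_inv c := by
    ext x
    by_cases hx : x ∈ A
    · simp [hx, (c.2.2 x).1 hx]
    · simp [hx]
  right_inv c := by
    ext x
    simp [x.2]

/-- Increasing maps to `[n + 1]` that send `A` to the top are increasing maps from the complement
of `A` to `[n + 1]`. -/
def weakExtendEquiv (n : ℕ) (A : Finset P) [DecidablePred (· ∈ A)] (hA : ∀ a ∈ A, IsMax a) :
    {c : P → Fin (n + 1) // Monotone c ∧ ∀ x ∈ A, c x = Fin.last n} ≃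
      {c : {x // x ∉ A} → Fin (n + 1) // Monotone c} where
  toFun c := ⟨fun x => c.1 x.1, fun x y hxy => c.2.1 hxy⟩
  invFun c := ⟨fun x => if h : x ∈ A then Fin.last n else c.1 ⟨x, h⟩, by
    refine ⟨fun x y hxy => ?_, fun x hx => by simp [hx]⟩
    by_cases hy : y ∈ A
    · simp [hy, Fin.le_last]
    · have hx : x ∉ A := fun h => hy ((hA x h).eq_of_le hxy ▸ h)
      simp only [hx, hy, dite_false]
      exact c.2 hxy⟩
  left_inv c := by
    ext x
    by_cases hx : x ∈ A
    · simp [hx, c.2.2 x hx]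
    · simp [hx]
  right_inv c := by
    ext x
    simp [x.2]

/-- Increasing maps to `[n + 1]` not sending any maximal element to the top are increasing maps
to `[n]`. -/
noncomputable def weakBelowTopEquiv [Finite P] (n : ℕ) :
    {c : P → Fin (n + 1) // Monotone c ∧ ∀ x, IsMax x → c x ≠ Fin.last n} ≃
      {c : P → Fin n // Monotone c} where
  toFun c := ⟨fun x => (c.1 x).castPred (by
      -- Every `x` lies below a maximal element; if `x` were sent to the top, that element would be
      -- too.
      obtain ⟨m, hxm, hm⟩ := Set.finite_univ.exists_le_maximal (Set.mem_univ x)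
      intro h
      refine c.2.2 m (fun y hy => hm.2 (Set.mem_univ y) hy) (le_antisymm (Fin.le_last _) ?_)
      exact h.ge.trans (c.2.1 hxm)), fun x y hxy => Fin.castPred_le_castPred_iff.2 (c.2.1 hxy)⟩
  invFun c := ⟨fun x => (c.1 x).castSucc, fun x y hxy => Fin.castSucc_le_castSucc_iff.2 (c.2 hxy),
    fun x _ => (Fin.castSucc_lt_last _).ne⟩
  left_inv c := by
    ext x
    simp
  right_inv c := by
    ext x
    simp

open Classical in
-- Sort the maps by their fibre `A` over the top color: strictness allows only maximal elements in
-- it.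
theorem card_strictMono_succ [Fintype P] (n : ℕ) :
    Nat.card {c : P → Fin (n + 1) // StrictMono c} =
      ∑ A ∈ (Finset.univ.filter fun x : P => IsMax x).powerset,
        Nat.card {c : {x // x ∉ A} → Fin n // StrictMono c} := by
  rw [Nat.card_eq_fintype_card, Fintype.card_subtype,
    Finset.card_eq_sum_card_fiberwise (f := fun c => Finset.univ.filter fun x => c x = Fin.last n)
      (t := (Finset.univ.filter fun x : P => IsMax x).powerset)]
  · refine Finset.sum_congr rfl fun A hA => ?_
    have hA' : ∀ a ∈ A, IsMax a := fun a ha =>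
      (Finset.mem_filter.1 (Finset.mem_powerset.1 hA ha)).2
    rw [← Nat.card_congr (strictFiberEquiv n A hA'), Nat.card_eq_fintype_card,
      Fintype.card_subtype, Finset.filter_filter]
    congr 1
    ext c
    simp only [Finset.mem_filter, Finset.mem_univ, true_and, Finset.ext_iff]
    exact and_congr_right fun _ => forall_congr' fun x => Iff.comm
  · intro c hc
    simp only [Finset.coe_filter, Finset.mem_univ, true_and, Set.mem_ofPred_eq] at hc
    simp only [Finset.coe_powerset, Set.mem_preimage, Set.mem_powerset_iff, Finset.coe_subset]
    intro x hx
    simp only [Finset.mem_filter, Finset.mem_univ, true_and] at hx ⊢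
    intro y hxy
    by_contra hyx
    have := hc (lt_of_le_not_ge hxy hyx)
    rw [hx] at this
    exact (Fin.le_last _).not_gt this

open Classical in
-- Inclusion-exclusion over the maximal elements sent to the top. The maps to `[n + 1]` that send
-- none of them there are the maps to `[n]`. Up to signs this is the recurrence of the strict count
-- read backwards, which is the source of reciprocity.
theorem card_monotone_eq_sum [Fintype P] (n : ℕ) :
    (Nat.card {c : P → Fin n // Monotone c} : ℤ) =
      ∑ A ∈ (Finset.univ.filter fun x : P => IsMax x).powerset,
        (-1) ^ A.card * (Nat.card {c : {x // x ∉ A} → Fin (n + 1) // Monotone c} : ℤ) := by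
  have key : ∀ A ∈ (Finset.univ.filter fun x : P => IsMax x).powerset,
      (-1) ^ A.card * (Nat.card {c : {x // x ∉ A} → Fin (n + 1) // Monotone c} : ℤ) =
        ∑ c ∈ Finset.univ.filter (fun c : P → Fin (n + 1) => Monotone c),
          if A ⊆ Finset.univ.filter (fun x => c x = Fin.last n) then (-1 : ℤ) ^ A.card else 0 := by
    intro A hA
    have hA' : ∀ a ∈ A, IsMax a := fun a ha =>
      (Finset.mem_filter.1 (Finset.mem_powerset.1 hA ha)).2
    rw [← Nat.card_congr (weakExtendEquiv n A hA'), Nat.card_eq_fintype_card,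
      Fintype.card_subtype, ← Finset.sum_filter, Finset.filter_filter, Finset.sum_const,
      nsmul_eq_mul, mul_comm]
    congr 3
    ext c
    simp [Finset.subset_iff]
  rw [Finset.sum_congr rfl key, Finset.sum_comm, ← Nat.card_congr (weakBelowTopEquiv n),
    Nat.card_eq_fintype_card, Fintype.card_subtype, ← Finset.filter_filter, Finset.card_filter]
  push_cast
  refine Finset.sum_congr rfl fun c _ => ?_
  rw [← Finset.sum_filter]
  have : (Finset.univ.filter fun x : P => IsMax x).powerset.filter
      (fun A => A ⊆ Finset.univ.filter (fun x => c x = Fin.last n)) =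
      (Finset.univ.filter fun x : P => IsMax x ∧ c x = Fin.last n).powerset := by
    ext A
    simp [Finset.subset_iff, forall_and]
  -- The alternating sum over subsets vanishes unless no maximal element is sent to the top.
  rw [this, Finset.sum_powerset_neg_one_pow_card]
  simp [Finset.filter_eq_empty_iff]

open Classical in
/-- Stanley's reciprocity theorem for order polynomials. -/
theorem exists_polynomial (P : Type u) [PartialOrder P] [Finite P] :
    ∃ q : ℚ[X],
      (∀ n : ℕ, q.eval (n : ℚ) = Nat.card {c : P → Fin n // StrictMono c}) ∧
      ∀ n : ℕ, q.eval (-(n : ℚ)) =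
        (-1) ^ Nat.card P * Nat.card {c : P → Fin n // Monotone c} := by
  obtain ⟨N, hN⟩ : ∃ N, N = Nat.card P := ⟨_, rfl⟩
  induction N using Nat.strong_induction_on generalizing P with
  | _ N ih =>
  have := Fintype.ofFinite P
  set M : Finset (Finset P) := (Finset.univ.filter fun x : P => IsMax x).powerset with hM
  have hcard : ∀ A : Finset P, Nat.card {x // x ∉ A} + A.card = Nat.card P := by
    intro A
    rw [Nat.card_eq_fintype_card, Nat.card_eq_fintype_card, Fintype.card_subtype_compl,
      Fintype.card_coe]
    exact Nat.sub_add_cancel (Finset.card_le_univ A)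
  have hex : ∀ A ∈ M.erase ∅, ∃ q : ℚ[X],
      (∀ n : ℕ, q.eval (n : ℚ) = Nat.card {c : {x // x ∉ A} → Fin n // StrictMono c}) ∧
      ∀ n : ℕ, q.eval (-(n : ℚ)) = (-1) ^ Nat.card {x // x ∉ A} *
        Nat.card {c : {x // x ∉ A} → Fin n // Monotone c} := by
    intro A hA
    refine ih _ ?_ _ rfl
    have := Finset.card_pos.2 (Finset.nonempty_iff_ne_empty.2 (Finset.ne_of_mem_erase hA))
    have := hcard A
    omega
  choose! r hr hr' using hex
  have h0 : ∅ ∈ M := Finset.empty_mem_powerset _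
  have hemp : ∀ (n : ℕ), Nat.card {c : {x // x ∉ (∅ : Finset P)} → Fin n // StrictMono c} =
      Nat.card {c : P → Fin n // StrictMono c} := fun n =>
    Nat.card_congr
      { toFun := fun c => ⟨fun x => c.1 ⟨x, Finset.notMem_empty x⟩, fun x y h => c.2 h⟩
        invFun := fun c => ⟨fun x => c.1 x.1, fun x y h => c.2 h⟩
        left_inv := fun _ => rfl
        right_inv := fun _ => rfl }
  have hemp' : ∀ (n : ℕ), Nat.card {c : {x // x ∉ (∅ : Finset P)} → Fin n // Monotone c} =
      Nat.card {c : P → Fin n // Monotone c} := fun n =>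
    Nat.card_congr
      { toFun := fun c => ⟨fun x => c.1 ⟨x, Finset.notMem_empty x⟩, fun x y h => c.2 h⟩
        invFun := fun c => ⟨fun x => c.1 x.1, fun x y h => c.2 h⟩
        left_inv := fun _ => rfl
        right_inv := fun _ => rfl }
  -- In the strict recurrence the term `A = ∅` is the count for `P` itself. The other terms, known
  -- by induction, give the difference `q (x + 1) - q x`.
  obtain ⟨q, hq0, hq⟩ := exists_discrete_antiderivative (∑ A ∈ M.erase ∅, r A)
    (Nat.card {c : P → Fin 0 // StrictMono c})
  simp only [eval_finsetSum] at hq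
  refine ⟨q, fun n => ?_, fun n => ?_⟩
  · induction n with
    | zero => simpa using hq0
    | succ n ihn =>
      rw [card_strictMono_succ, ← Finset.add_sum_erase _ _ h0, hemp]
      push_cast
      rw [hq, ihn, Finset.sum_congr rfl fun A hA => hr A hA n]
  · induction n with
    | zero =>
      rw [Nat.cast_zero, neg_zero, hq0]
      rcases isEmpty_or_nonempty P with h | h
      · have h1 : ∀ c : P → Fin 0, StrictMono c := fun c x => isEmptyElim x
        have h2 : ∀ c : P → Fin 0, Monotone c := fun c x => isEmptyElim x
        simp [h1, h2]
      · simp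
    | succ n ihn =>
      -- The difference equation at `-(n + 1)` relates `q (-n)` to `q (-(n + 1))`, exactly as the
      -- weak recurrence relates the counts for `n` and `n + 1`.
      have h1 := hq (-((n + 1 : ℕ) : ℚ))
      have h2 : (-((n + 1 : ℕ) : ℚ)) + 1 = -(n : ℚ) := by
        push_cast
        ring
      rw [h2, ihn] at h1
      have h3 := congrArg (Int.cast : ℤ → ℚ) (card_monotone_eq_sum (P := P) n)
      rw [← Finset.add_sum_erase _ _ h0, hemp'] at h3
      push_cast at h3
      rw [Finset.sum_congr rfl fun A hA => hr' A hA (n + 1)] at h1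
      rw [h3, Finset.card_empty, pow_zero, one_mul, mul_add, Finset.mul_sum] at h1
      have h4 : ∀ A ∈ M.erase ∅, (-1 : ℚ) ^ Nat.card P * ((-1) ^ A.card *
          (Nat.card {c : {x // x ∉ A} → Fin (n + 1) // Monotone c} : ℚ)) =
          (-1) ^ Nat.card {x // x ∉ A} *
            (Nat.card {c : {x // x ∉ A} → Fin (n + 1) // Monotone c} : ℚ) := by
        intro A _
        rw [← hcard A, pow_add, mul_assoc, ← mul_assoc ((-1 : ℚ) ^ A.card) ((-1 : ℚ) ^ A.card),
          ← mul_pow]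
        simp
      rw [Finset.sum_congr rfl h4] at h1
      linarith

end OrderPolynomial

theorem Decomposition.mem_ground_iff {α : Type u} [DecidableEq α] {V : Finset α} {n : ℕ}
    (D : Decomposition V n) {x : α} : x ∈ V ↔ ∃ i, x ∈ D.part i := by
  conv_lhs => rw [← D.union_eq]
  simp

/-! ## The splitting of a building set along a decomposition -/

namespace BuildingSet

variable {α : Type u} [DecidableEq α]

/-- The disjoint union of the building sets `(B|_{V₁ ⊔ ⋯ ⊔ V_i})/_{V₁ ⊔ ⋯ ⊔ V_{i-1}}`. -/
def split : {V : Finset α} → (n : ℕ) → Decomposition V n → BuildingSet V → BuildingSet V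
  | _, 0, D, B => (B.restrict ∅ (Finset.empty_subset _)).restrict _ D.eq_empty.subset
  | _, n + 1, D, B =>
    (B.restrict (D.part 0) (D.part_subset 0)).disjUnion D.isDisjUnion
      (split n D.tail (B.contract D.isDisjUnion))

/-- Contracting by the first part discards the sets inside it and trims the others, so `e` survives
until the last part that it meets. The recursive definition thus becomes a description by the
largest index `i` of a part meeting `e`. -/
theorem mem_split {V : Finset α} (n : ℕ) (D : Decomposition V n) (B : BuildingSet V)
    (s : Finset α) :
    s ∈ (B.split n D).sets ↔ ∃ e ∈ B.sets, ∃ i, (e ∩ D.part i).Nonempty ∧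
      (∀ j, i < j → Disjoint e (D.part j)) ∧ s = e ∩ D.part i := by
  induction n generalizing V with
  | zero =>
    simp only [split, restrict, Finset.mem_filter, Finset.subset_empty, IsEmpty.exists_iff,
      and_false, exists_false, iff_false, not_and]
    rintro ⟨hs, rfl⟩
    exact absurd (B.nonempty_of_mem _ hs) Finset.not_nonempty_empty
  | succ n ih =>
    have hdisj : ∀ i : Fin n, D.part i.succ ⊆ V \ D.part 0 := fun i =>
      Finset.subset_sdiff.2 ⟨D.part_subset _, D.disjoint _ _ (Fin.succ_ne_zero i)⟩
    simp only [split, disjUnion, Finset.mem_union, ih, restrict, contract, Finset.mem_filter,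
      Finset.mem_image]
    constructor
    · rintro (⟨hs, hs0⟩ | ⟨_, ⟨e, ⟨he, he0⟩, rfl⟩, i, hne, hlt, rfl⟩)
      · refine ⟨s, hs, 0, ?_, fun j hj => ?_, (Finset.inter_eq_left.2 hs0).symm⟩
        · rw [Finset.inter_eq_left.2 hs0]
          exact B.nonempty_of_mem s hs
        · exact Finset.disjoint_of_subset_left hs0 (D.disjoint _ _ hj.ne)
      · have h : ∀ j : Fin n, e ∩ (V \ D.part 0) ∩ D.part j.succ = e ∩ D.part j.succ := fun j => by
          rw [Finset.inter_assoc, Finset.inter_eq_right.2 (hdisj j)]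
        refine ⟨e, he, i.succ, ?_, fun j hj => ?_, h i⟩
        · rw [← h]
          exact hne
        · obtain ⟨j, rfl⟩ := Fin.exists_succ_eq.2 (Fin.ne_zero_of_lt hj)
          have := hlt j (Fin.succ_lt_succ_iff.1 hj)
          rw [Finset.disjoint_iff_inter_eq_empty] at this ⊢
          rw [← h]
          exact this
    · rintro ⟨e, he, i, hne, hlt, rfl⟩
      induction i using Fin.cases with
      | zero =>
        have h0 : e ⊆ D.part 0 := fun x hx => by
          obtain ⟨j, hj⟩ := D.mem_ground_iff.1 (B.subset_ground e he hx)
          induction j using Fin.cases with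
          | zero => exact hj
          | succ j => exact absurd hj (Finset.disjoint_left.1 (hlt _ (Fin.succ_pos j)) hx)
        rw [Finset.inter_eq_left.2 h0]
        exact Or.inl ⟨he, h0⟩
      | succ i =>
        right
        have h : ∀ j : Fin n, e ∩ (V \ D.part 0) ∩ D.part j.succ = e ∩ D.part j.succ := fun j => by
          rw [Finset.inter_assoc, Finset.inter_eq_right.2 (hdisj j)]
        refine ⟨_, ⟨e, ⟨he, fun h0 => ?_⟩, rfl⟩, i, ?_, fun j hj => ?_, (h i).symm⟩
        · obtain ⟨x, hx⟩ := hne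
          rw [Finset.mem_inter] at hx
          exact (Finset.mem_sdiff.1 (hdisj i hx.2)).2 (h0 hx.1)
        · exact (h i).symm ▸ hne
        · exact Finset.disjoint_of_subset_left Finset.inter_subset_left
            (hlt j.succ (Fin.succ_lt_succ_iff.2 hj))

end BuildingSet

/-! ### Iterated product and coproduct on basis elements -/

namespace BS

variable (K : Type v) [Field K] {α : Type u} [DecidableEq α]

theorem mul_single {V₁ V₂ V : Finset α} (h : IsDisjUnion V₁ V₂ V) (B₁ : BuildingSet V₁)
    (B₂ : BuildingSet V₂) :
    mul K h (Finsupp.single B₁ 1 ⊗ₜ[K] Finsupp.single B₂ 1) =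
      Finsupp.single (B₁.disjUnion h B₂) 1 := by
  simp [mul, finsuppTensorFinsupp'_single_tmul_single, Finsupp.lmapDomain_apply,
    Finsupp.mapDomain_single]

theorem comul_single {V₁ V₂ V : Finset α} (h : IsDisjUnion V₁ V₂ V) (B : BuildingSet V) :
    comul K h (Finsupp.single B 1) =
      Finsupp.single (B.restrict V₁ (h.2 ▸ Finset.subset_union_left)) 1 ⊗ₜ[K]
        Finsupp.single (B.contract h) 1 := by
  simp [comul, finsuppTensorFinsupp'_symm_single_eq_single_one_tmul, Finsupp.lmapDomain_apply,
    Finsupp.mapDomain_single]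

theorem iterMul_iterComul_single {V : Finset α} (n : ℕ) (D : Decomposition V n)
    (B : BuildingSet V) :
    iterMul K n D (iterComul K n D (Finsupp.single B 1)) = Finsupp.single (B.split n D) 1 := by
  induction n generalizing V with
  | zero =>
    change Finsupp.lmapDomain K K _ (Finsupp.lmapDomain K K _ _) = _
    simp only [Finsupp.lmapDomain_apply, Finsupp.mapDomain_single, BuildingSet.split]
  | succ n ih =>
    change mul K D.isDisjUnion (TensorProduct.map LinearMap.id (iterMul K n D.tail)
      (TensorProduct.map LinearMap.id (iterComul K n D.tail)
        (comul K D.isDisjUnion (Finsupp.single B 1)))) = _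
    rw [comul_single, TensorProduct.map_tmul, TensorProduct.map_tmul, ih]
    exact mul_single K _ _ _

end BS

namespace BSCharacter

variable {K : Type v} [Field K] {α : Type u} [DecidableEq α]

theorem chi_single (ζ : BSCharacter K α) {V : Finset α} (B : BuildingSet V) (n : ℕ) :
    ζ.chi V (Finsupp.single B 1) n = ∑ D : Decomposition V n, ζ.val (B.split n D) := by
  simp only [chi, BS.iterMul_iterComul_single, val]

end BSCharacter

/-! ### Decompositions as colorings -/

namespace Decomposition

variable {α : Type u} [DecidableEq α]

/-- Decompositions of `V` into `n` parts are colorings of `V` with `n` colors. -/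
noncomputable def equivColoring (V : Finset α) (n : ℕ) :
    ({v // v ∈ V} → Fin n) ≃ Decomposition V n :=
  Equiv.ofBijective
    (fun c =>
      { part := fun i => (V.attach.filter fun v => c v = i).image Subtype.val
        disjoint := by
          intro i j hij
          rw [Finset.disjoint_left]
          intro x hx hx'
          obtain ⟨a, ha, rfl⟩ := Finset.mem_image.1 hx
          obtain ⟨b, hb, hab⟩ := Finset.mem_image.1 hx'
          obtain rfl := Subtype.ext hab
          exact hij ((Finset.mem_filter.1 ha).2.symm.trans (Finset.mem_filter.1 hb).2)
        union_eq := by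
          ext x
          simp })
    (by
      constructor
      · intro c c' h
        funext v
        have hv := congrFun (congrArg Decomposition.part h) (c v)
        have : v.1 ∈ (V.attach.filter fun w => c w = c v).image Subtype.val :=
          Finset.mem_image_of_mem _ (Finset.mem_filter.2 ⟨Finset.mem_attach _ _, rfl⟩)
        simp only at hv
        rw [hv] at this
        obtain ⟨w, hw, hwv⟩ := Finset.mem_image.1 this
        obtain rfl := Subtype.ext hwv
        exact (Finset.mem_filter.1 hw).2.symm
      · intro D
        have hex : ∀ v : {v // v ∈ V}, ∃ i, v.1 ∈ D.part i := fun v =>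
          D.mem_ground_iff.1 v.2
        choose c hc using hex
        refine ⟨c, Decomposition.ext (funext fun i => Finset.ext fun x => ?_)⟩
        simp only [Finset.mem_image, Finset.mem_filter, Finset.mem_attach, true_and]
        constructor
        · rintro ⟨v, rfl, rfl⟩
          exact hc v
        · intro hx
          refine ⟨⟨x, D.part_subset i hx⟩, ?_, rfl⟩
          by_contra hne
          exact Finset.disjoint_left.1 (D.disjoint _ _ hne) (hc _) hx)

theorem mem_part_equivColoring {V : Finset α} {n : ℕ} (c : {v // v ∈ V} → Fin n) (i : Fin n)
    (v : {v // v ∈ V}) : v.1 ∈ (equivColoring V n c).part i ↔ c v = i := by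
  change v.1 ∈ (V.attach.filter fun v => c v = i).image Subtype.val ↔ c v = i
  simp

end Decomposition

/-! ## Forests and colorings -/

namespace BuildingSet

variable {α : Type u} [DecidableEq α] {V : Finset α} (B : BuildingSet V)

/-- The sets `f i` are glued to `e` one at a time, each of them meeting `e`. -/
theorem union_biUnion_mem {ι : Type*} (s : Finset ι) (f : ι → Finset α)
    {e : Finset α} (he : e ∈ B.sets) (hs : ∀ i ∈ s, f i ∈ B.sets ∧ (f i ∩ e).Nonempty) :
    e ∪ s.biUnion f ∈ B.sets := by
  classical
  induction s using Finset.induction_on with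
  | empty => simpa using he
  | insert i s _ ih =>
    have h1 := ih fun j hj => hs j (Finset.mem_insert_of_mem hj)
    obtain ⟨h2, x, hx⟩ := hs i (Finset.mem_insert_self i s)
    rw [Finset.mem_inter] at hx
    rw [Finset.biUnion_insert, Finset.union_left_comm]
    exact B.union_mem _ h2 _ h1
      ⟨x, Finset.mem_inter.2 ⟨hx.1, Finset.mem_union_left _ hx.2⟩⟩

theorem mem_components {e : Finset α} :
    e ∈ B.components ↔ e ∈ B.sets ∧ ∀ e' ∈ B.sets, e ⊆ e' → e' = e := by
  simp [components]

/-- The largest connected set containing `v` on which `C` is maximal at `v`. -/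
def cluster (C : α → ℕ) (v : α) : Finset α :=
  (B.sets.filter fun e => v ∈ e ∧ ∀ w ∈ e, C w ≤ C v).biUnion id

variable {B} {C : α → ℕ} {v w : α}

theorem subset_cluster {e : Finset α} (he : e ∈ B.sets) (hv : v ∈ e) (h : ∀ w ∈ e, C w ≤ C v) :
    e ⊆ B.cluster C v :=
  Finset.subset_biUnion_of_mem id (Finset.mem_filter.2 ⟨he, hv, h⟩)

theorem le_of_mem_cluster (h : w ∈ B.cluster C v) : C w ≤ C v := by
  obtain ⟨e, he, hw⟩ := Finset.mem_biUnion.1 h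
  exact (Finset.mem_filter.1 he).2.2 w hw

theorem mem_cluster_self (hv : v ∈ V) : v ∈ B.cluster C v :=
  subset_cluster (B.singleton_mem v hv) (Finset.mem_singleton_self v)
    (fun w hw => by rw [Finset.mem_singleton.1 hw]) (Finset.mem_singleton_self v)

theorem cluster_mem (hv : v ∈ V) : B.cluster C v ∈ B.sets := by
  have h : {v} ∪ B.cluster C v = B.cluster C v :=
    Finset.union_eq_right.2 (Finset.singleton_subset_iff.2 (mem_cluster_self hv))
  rw [← h]
  refine B.union_biUnion_mem _ id (B.singleton_mem v hv) fun e he => ?_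
  rw [Finset.mem_filter] at he
  exact ⟨he.1, v, Finset.mem_inter.2 ⟨he.2.1, Finset.mem_singleton_self v⟩⟩

/-- The union of the two clusters is connected and `C` is maximal on it at `v`, so it lies in the
cluster of `v`. Consequently clusters are nested or disjoint. -/
theorem cluster_subset_of_inter (hv : v ∈ V) (hw : w ∈ V) (hvw : C w ≤ C v)
    (h : (B.cluster C w ∩ B.cluster C v).Nonempty) : B.cluster C w ⊆ B.cluster C v := by
  refine Finset.subset_union_left.trans (subset_cluster (B.union_mem _ (cluster_mem hw) _
    (cluster_mem hv) h) (Finset.mem_union_right _ (mem_cluster_self hv)) fun x hx => ?_)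
  rcases Finset.mem_union.1 hx with hx | hx
  · exact (le_of_mem_cluster hx).trans hvw
  · exact le_of_mem_cluster hx

theorem cluster_subset_of_mem (hv : v ∈ V) (h : w ∈ B.cluster C v) :
    B.cluster C w ⊆ B.cluster C v := by
  have hw : w ∈ V := B.subset_ground _ (cluster_mem hv) h
  exact cluster_subset_of_inter hv hw (le_of_mem_cluster h)
    ⟨w, Finset.mem_inter.2 ⟨mem_cluster_self hw, h⟩⟩

end BuildingSet

/-! ### Rooted forests and their lower sets -/

namespace RootedForest

variable {α : Type u} [DecidableEq α] {V : Finset α}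

theorem mem_below (F : RootedForest V) (p : F.Node) (x : α) :
    x ∈ F.below p ↔ ∃ q : F.Node, F.le q p ∧ x ∈ q.1 := by
  simp only [below, Finset.mem_biUnion, Finset.mem_filter, Finset.mem_univ, true_and]

theorem subset_below (F : RootedForest V) (p : F.Node) : p.1 ⊆ F.below p :=
  fun _ hx => (F.mem_below p _).2 ⟨p, F.le_refl p, hx⟩

theorem node_nonempty (F : RootedForest V) (p : F.Node) : p.1.Nonempty :=
  F.nodes.nonempty_of_mem_parts p.2

theorem node_subset (F : RootedForest V) (p : F.Node) : p.1 ⊆ V := F.nodes.subset p.2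

theorem node_eq (F : RootedForest V) {p q : F.Node} {x : α} (hp : x ∈ p.1) (hq : x ∈ q.1) :
    p = q :=
  Subtype.ext (F.nodes.eq_of_mem_parts p.2 q.2 hp hq)

theorem exists_node (F : RootedForest V) {x : α} (hx : x ∈ V) : ∃ p : F.Node, x ∈ p.1 := by
  obtain ⟨p, hp, hxp⟩ := F.nodes.exists_mem hx
  exact ⟨⟨p, hp⟩, hxp⟩

theorem le_iff_below_subset (F : RootedForest V) (p q : F.Node) :
    F.le p q ↔ F.below p ⊆ F.below q := by
  constructor
  · intro h x hx
    obtain ⟨r, hr, hxr⟩ := (F.mem_below p x).1 hx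
    exact (F.mem_below q x).2 ⟨r, F.le_trans _ _ _ hr h, hxr⟩
  · intro h
    obtain ⟨x, hx⟩ := F.node_nonempty p
    obtain ⟨r, hr, hxr⟩ := (F.mem_below q x).1 (h (F.subset_below p hx))
    rwa [F.node_eq hx hxr]

theorem ext_of_le {F G : RootedForest V} (h : F.nodes = G.nodes)
    (hle : ∀ (p q : F.Node) (p' q' : G.Node), p.1 = p'.1 → q.1 = q'.1 → (F.le p q ↔ G.le p' q')) :
    F = G := by
  obtain ⟨π, l, _, _, _, _⟩ := F
  obtain ⟨π', l', _, _, _, _⟩ := G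
  obtain rfl : π = π' := h
  obtain rfl : l = l' := by
    funext p q
    exact propext (hle p q p q rfl rfl)
  rfl

/-- A rooted forest is determined by the sets `F_{≤ p}`. -/
theorem ext_of_below {F G : RootedForest V} (T : α → Finset α)
    (hF : ∀ (p : F.Node), ∀ v ∈ p.1, F.below p = T v)
    (hG : ∀ (p : G.Node), ∀ v ∈ p.1, G.below p = T v) : F = G := by
  -- The nodes are the fibres of `T`, since distinct nodes have distinct sets `F_{≤ p}`.
  have key : ∀ (F : RootedForest V), (∀ (p : F.Node), ∀ v ∈ p.1, F.below p = T v) →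
      ∀ s, s ∈ F.nodes.parts ↔ ∃ v ∈ V, s = V.filter fun w => T w = T v := by
    intro F hF s
    have h1 : ∀ (p : F.Node), ∀ v ∈ p.1, p.1 = V.filter fun w => T w = T v := by
      intro p v hv
      ext w
      rw [Finset.mem_filter]
      constructor
      · intro hw
        exact ⟨F.node_subset p hw, by rw [← hF p w hw, hF p v hv]⟩
      · rintro ⟨hwV, hw⟩
        obtain ⟨q, hq⟩ := F.exists_node hwV
        have h2 : F.below q = F.below p := by rw [hF q w hq, hw, hF p v hv]
        rwa [F.le_antisymm p q ((F.le_iff_below_subset _ _).2 h2.ge)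
          ((F.le_iff_below_subset _ _).2 h2.le)]
    constructor
    · intro hs
      obtain ⟨v, hv⟩ := F.node_nonempty ⟨s, hs⟩
      exact ⟨v, F.node_subset ⟨s, hs⟩ hv, h1 ⟨s, hs⟩ v hv⟩
    · rintro ⟨v, hv, rfl⟩
      obtain ⟨p, hp⟩ := F.exists_node hv
      rw [← h1 p v hp]
      exact p.2
  refine ext_of_le (Finpartition.ext (Finset.ext fun s => by rw [key F hF, key G hG])) ?_
  intro p q p' q' hp hq
  obtain ⟨v, hv⟩ := F.node_nonempty p
  obtain ⟨w, hw⟩ := F.node_nonempty q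
  rw [le_iff_below_subset, le_iff_below_subset, hF p v hv, hF q w hw, hG p' v (hp ▸ hv),
    hG q' w (hq ▸ hw)]

end RootedForest

/-! ### The forest of clusters of a coloring -/

namespace BuildingSet

variable {α : Type u} [DecidableEq α] {V : Finset α}

theorem mem_ofSetSetoid_cluster {B : BuildingSet V} {C : α → ℕ}
    [DecidableRel (Setoid.ker (B.cluster C)).r] {p : Finset α}
    (hp : p ∈ (Finpartition.ofSetSetoid (Setoid.ker (B.cluster C)) V).parts) {v w : α}
    (hv : v ∈ p) : w ∈ p ↔ w ∈ V ∧ B.cluster C v = B.cluster C w := by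
  obtain ⟨a, -, rfl⟩ := Finset.mem_image.1 hp
  simp only [Finset.mem_filter] at hv ⊢
  have h1 : B.cluster C a = B.cluster C v := hv.2
  rw [← h1]
  exact Iff.rfl

open Classical in
/-- The forest whose nodes are the fibres of `B.cluster C`, ordered by inclusion of clusters. -/
noncomputable def clusterForest (B : BuildingSet V) (C : α → ℕ) : RootedForest V where
  nodes := Finpartition.ofSetSetoid (Setoid.ker (B.cluster C)) V
  le p q := ∀ v ∈ p.1, ∀ w ∈ q.1, B.cluster C v ⊆ B.cluster C w
  le_refl p v hv w hw := ((mem_ofSetSetoid_cluster p.2 hv).1 hw).2.subset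
  le_trans p q r hpq hqr v hv w hw := by
    obtain ⟨x, hx⟩ := Finpartition.nonempty_of_mem_parts _ q.2
    exact (hpq v hv x hx).trans (hqr x hx w hw)
  le_antisymm p q hpq hqp := by
    obtain ⟨v, hv⟩ := Finpartition.nonempty_of_mem_parts _ p.2
    obtain ⟨w, hw⟩ := Finpartition.nonempty_of_mem_parts _ q.2
    refine Subtype.ext (Finpartition.eq_of_mem_parts _ p.2 q.2 hv
      ((mem_ofSetSetoid_cluster q.2 hw).2 ⟨Finpartition.subset _ p.2 hv, ?_⟩))
    exact (hqp w hw v hv).antisymm (hpq v hv w hw)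
  chain p q r hpq hpr := by
    obtain ⟨v, hv⟩ := Finpartition.nonempty_of_mem_parts _ p.2
    obtain ⟨a, ha⟩ := Finpartition.nonempty_of_mem_parts _ q.2
    obtain ⟨b, hb⟩ := Finpartition.nonempty_of_mem_parts _ r.2
    have hvV := Finpartition.subset _ p.2 hv
    have haV := Finpartition.subset _ q.2 ha
    have hbV := Finpartition.subset _ r.2 hb
    have h1 := hpq v hv a ha (mem_cluster_self hvV)
    have h2 := hpr v hv b hb (mem_cluster_self hvV)
    -- Both clusters contain `v`, so the one with the smaller color at its defining vertex is inside
    -- the other.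
    rcases le_total (C a) (C b) with h | h
    · left
      intro a' ha' b' hb'
      rw [← ((mem_ofSetSetoid_cluster q.2 ha).1 ha').2, ← ((mem_ofSetSetoid_cluster r.2 hb).1 hb').2]
      exact cluster_subset_of_inter hbV haV h ⟨v, Finset.mem_inter.2 ⟨h1, h2⟩⟩
    · right
      intro b' hb' a' ha'
      rw [← ((mem_ofSetSetoid_cluster q.2 ha).1 ha').2, ← ((mem_ofSetSetoid_cluster r.2 hb).1 hb').2]
      exact cluster_subset_of_inter haV hbV h ⟨v, Finset.mem_inter.2 ⟨h2, h1⟩⟩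

variable {B : BuildingSet V} {C : α → ℕ}

theorem mem_clusterForest_node {p : (B.clusterForest C).Node} {v w : α} (hv : v ∈ p.1) :
    w ∈ p.1 ↔ w ∈ V ∧ B.cluster C v = B.cluster C w := by
  classical
  exact mem_ofSetSetoid_cluster p.2 hv

theorem clusterForest_le {p q : (B.clusterForest C).Node} {v w : α} (hv : v ∈ p.1)
    (hw : w ∈ q.1) : (B.clusterForest C).le p q ↔ B.cluster C v ⊆ B.cluster C w := by
  refine ⟨fun h => h v hv w hw, fun h v' hv' w' hw' => ?_⟩
  rw [← ((mem_clusterForest_node hv).1 hv').2, ← ((mem_clusterForest_node hw).1 hw').2]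
  exact h

theorem clusterForest_below {p : (B.clusterForest C).Node} {v : α} (hv : v ∈ p.1) :
    (B.clusterForest C).below p = B.cluster C v := by
  have hvV := (B.clusterForest C).node_subset p hv
  ext x
  rw [RootedForest.mem_below]
  constructor
  · rintro ⟨q, hq, hx⟩
    exact (clusterForest_le hx hv).1 hq
      (mem_cluster_self ((B.clusterForest C).node_subset q hx))
  · intro hx
    obtain ⟨q, hq⟩ :=
      (B.clusterForest C).exists_node (B.subset_ground _ (cluster_mem hvV) hx)
    exact ⟨q, (clusterForest_le hq hv).2 (cluster_subset_of_mem hvV hx), hq⟩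

/-- Each condition comes from the maximality of clusters. A connected set containing a root's
cluster lies in the cluster of a vertex where it attains its largest color, hence in the root's. If
the union over an incomparable family were connected, it would lie in the cluster of a member of
largest color, making the other members comparable to that one. -/
theorem isBForest_clusterForest : IsBForest B (B.clusterForest C) := by
  set F := B.clusterForest C with hF
  refine ⟨fun r hr => ?_, fun p => ?_, fun s hs hinc hmem => ?_⟩
  · obtain ⟨v, hv⟩ := F.node_nonempty r
    have hvV := F.node_subset r hv
    rw [clusterForest_below hv, mem_components]
    refine ⟨cluster_mem hvV, fun e he hve => ?_⟩
    obtain ⟨m, hme, hm⟩ := e.exists_max_image C ⟨v, hve (mem_cluster_self hvV)⟩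
    obtain ⟨q, hq⟩ := F.exists_node (B.subset_ground e he hme)
    have h1 : e ⊆ B.cluster C m := subset_cluster he hme hm
    obtain rfl := hr q ((clusterForest_le hv hq).2 (hve.trans h1))
    rw [((mem_clusterForest_node hv).1 hq).2] at hve ⊢
    exact h1.antisymm hve
  · obtain ⟨v, hv⟩ := F.node_nonempty p
    rw [clusterForest_below hv]
    exact cluster_mem (F.node_subset p hv)
  · choose v hv using F.node_nonempty
    obtain ⟨p, hp, hmax⟩ := s.exists_max_image (fun p => C (v p))
      (Finset.card_pos.1 (by omega))
    obtain ⟨q, hq, hqp⟩ := Finset.exists_mem_ne (by omega : 1 < s.card) p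
    refine hinc q hq p hp hqp ?_
    rw [F.le_iff_below_subset]
    refine (Finset.subset_biUnion_of_mem F.below hq).trans ?_
    rw [clusterForest_below (hv p)]
    refine subset_cluster hmem
      (Finset.mem_biUnion.2 ⟨p, hp, F.subset_below p (hv p)⟩) fun w hw => ?_
    obtain ⟨r, hr, hwr⟩ := Finset.mem_biUnion.1 hw
    rw [clusterForest_below (hv r)] at hwr
    exact (le_of_mem_cluster hwr).trans (hmax r hr)

end BuildingSet

/-- The extension of a coloring by `0`. -/
def extendColoring {α : Type u} [DecidableEq α] {V : Finset α} {n : ℕ}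
    (c : {v // v ∈ V} → Fin n) (x : α) : ℕ :=
  if h : x ∈ V then c ⟨x, h⟩ else 0

theorem extendColoring_coe {α : Type u} [DecidableEq α] {V : Finset α} {n : ℕ}
    (c : {v // v ∈ V} → Fin n) {x : α} (hx : x ∈ V) : extendColoring c x = c ⟨x, hx⟩ := by
  simp [extendColoring, hx]

namespace BuildingSet

variable {α : Type u} [DecidableEq α] {V : Finset α} {B : BuildingSet V}

/-- Nested clusters with equal colors at their defining vertices contain each other, so they belong
to the same node; this gives strictness. -/
theorem strictlyCompatible_clusterForest {n : ℕ} (c : {v // v ∈ V} → Fin n) :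
    (B.clusterForest (extendColoring c)).StrictlyCompatible c := by
  have key : ∀ v w : {v // v ∈ V}, B.cluster (extendColoring c) v.1 ⊆
      B.cluster (extendColoring c) w.1 → c v ≤ c w := by
    intro v w h
    have := le_of_mem_cluster (h (mem_cluster_self v.2))
    rwa [extendColoring_coe c v.2, extendColoring_coe c w.2] at this
  refine ⟨fun p v w hv hw => ?_, fun p q hle hne v w hv hw => ?_⟩
  · have h := ((mem_clusterForest_node hv).1 hw).2
    exact le_antisymm (key v w h.subset) (key w v h.symm.subset)
  · have h := (clusterForest_le hv hw).1 hle
    refine lt_of_le_of_ne (key v w h) fun heq => hne ?_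
    have h1 : B.cluster (extendColoring c) w.1 ⊆ B.cluster (extendColoring c) v.1 := by
      refine cluster_subset_of_inter v.2 w.2 ?_
        ⟨v.1, Finset.mem_inter.2 ⟨h (mem_cluster_self v.2), mem_cluster_self v.2⟩⟩
      rw [extendColoring_coe c v.2, extendColoring_coe c w.2, heq]
    exact RootedForest.le_antisymm _ _ _ hle ((clusterForest_le hw hv).2 h1)

end BuildingSet

namespace RootedForest

variable {α : Type u} [DecidableEq α] {V : Finset α}

/-- The nodes of a forest, as a partially ordered type. -/
def OrderedNode (F : RootedForest V) : Type u := F.Node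

instance (F : RootedForest V) : PartialOrder F.OrderedNode where
  le := F.le
  le_refl := F.le_refl
  le_trans := F.le_trans
  le_antisymm := F.le_antisymm

instance (F : RootedForest V) : Finite F.OrderedNode := inferInstanceAs (Finite F.Node)

end RootedForest

open Classical in
theorem BuildingSet.mem_induced {α : Type u} [DecidableEq α] {V : Finset α} {B : BuildingSet V}
    {F : RootedForest V} {s : Finset α} :
    s ∈ (B.induced F).sets ↔ s ⊆ V ∧ ∃ e ∈ B.sets, ∃ p : F.Node, (e ∩ p.1).Nonempty ∧
      (∀ q : F.Node, (e ∩ q.1).Nonempty → F.le q p) ∧ s = e ∩ p.1 := by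
  simp only [BuildingSet.induced, Finset.mem_filter, Finset.mem_powerset]

/-! ### Uniqueness of the forest of a coloring, and the building set `B ∩ F` -/

namespace IsBForest

variable {α : Type u} [DecidableEq α] {V : Finset α} {B : BuildingSet V} {F : RootedForest V}

/-- The nodes meeting a connected set have a maximum. -/
theorem exists_max_node (hF : IsBForest B F) {e : Finset α} (he : e ∈ B.sets) :
    ∃ p : F.Node, (e ∩ p.1).Nonempty ∧ ∀ q : F.Node, (e ∩ q.1).Nonempty → F.le q p := by
  classical
  set s : Set F.OrderedNode := {q | (e ∩ q.1).Nonempty} with hs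
  set M : Finset F.Node := Finset.univ.filter fun q => Maximal (fun x => x ∈ s) (q : F.OrderedNode)
    with hM
  have hmax : ∀ q : F.Node, (e ∩ q.1).Nonempty → ∃ m ∈ M, F.le q m := by
    intro q hq
    obtain ⟨m, hqm, hm⟩ := s.toFinite.exists_le_maximal (show (q : F.OrderedNode) ∈ s from hq)
    exact ⟨m, Finset.mem_filter.2 ⟨Finset.mem_univ _, hm⟩, hqm⟩
  have hmeet : ∀ m ∈ M, (e ∩ m.1).Nonempty := fun m hm => (Finset.mem_filter.1 hm).2.1
  have hsub : e ⊆ M.biUnion F.below := by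
    intro x hx
    obtain ⟨q, hq⟩ := F.exists_node (B.subset_ground e he hx)
    obtain ⟨m, hm, hqm⟩ := hmax q ⟨x, Finset.mem_inter.2 ⟨hx, hq⟩⟩
    exact Finset.mem_biUnion.2 ⟨m, hm, (F.mem_below m x).2 ⟨q, hqm, hq⟩⟩
  -- `M` holds the maximal nodes meeting `e`. The sets below them cover `e` and each meets it, so
  -- their union is connected; the incomparability axiom then leaves room for only one.
  have hmem : M.biUnion F.below ∈ B.sets := by
    rw [← Finset.union_eq_right.2 hsub]
    refine B.union_biUnion_mem M F.below he fun m hm => ⟨hF.node m, ?_⟩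
    rw [Finset.inter_comm]
    exact (hmeet m hm).mono (Finset.inter_subset_inter_left (F.subset_below m))
  have hcard : M.card < 2 := by
    by_contra hc
    refine hF.incomparable M (not_lt.1 hc) (fun p hp q hq hpq hle => hpq ?_) hmem
    exact F.le_antisymm p q hle
      ((Finset.mem_filter.1 hp).2.2 (show (q : F.OrderedNode) ∈ s from hmeet q hq) hle)
  obtain ⟨x, hx⟩ := B.nonempty_of_mem e he
  obtain ⟨p, hp, -⟩ := Finset.mem_biUnion.1 (hsub hx)
  refine ⟨p, hmeet p hp, fun q hq => ?_⟩
  obtain ⟨m, hm, hqm⟩ := hmax q hq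
  rwa [Finset.card_le_one.1 (Nat.lt_succ_iff.1 hcard) p hp m hm]

/-- `F_{≤ p}` is connected with its largest color on `p`, so it lies in the cluster. Conversely, the
maximum node `q` meeting the cluster is above `p` but has no larger color, so strictness forces `q =
p`. -/
theorem below_eq_cluster (hF : IsBForest B F) {n : ℕ} {c : {v // v ∈ V} → Fin n}
    (hc : F.StrictlyCompatible c) (p : F.Node) (v : α) (hv : v ∈ p.1) :
    F.below p = B.cluster (extendColoring c) v := by
  have hvV := F.node_subset p hv
  apply Finset.Subset.antisymm
  · refine BuildingSet.subset_cluster (hF.node p) (F.subset_below p hv) fun w hw => ?_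
    obtain ⟨q, hq, hwq⟩ := (F.mem_below p w).1 hw
    have hwV := F.node_subset q hwq
    rw [extendColoring_coe c hvV, extendColoring_coe c hwV]
    by_cases hqp : q = p
    · subst hqp
      exact (hc.1 q ⟨w, hwV⟩ ⟨v, hvV⟩ hwq hv).le
    · exact (hc.2 q p hq hqp ⟨w, hwV⟩ ⟨v, hvV⟩ hwq hv).le
  · obtain ⟨q, ⟨x, hx⟩, hmax⟩ := hF.exists_max_node
      (BuildingSet.cluster_mem (C := extendColoring c) (B := B) hvV)
    rw [Finset.mem_inter] at hx
    have hxV := F.node_subset q hx.2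
    have hpq := hmax p ⟨v, Finset.mem_inter.2 ⟨BuildingSet.mem_cluster_self hvV, hv⟩⟩
    obtain rfl : p = q := by
      by_contra hne
      have h1 := hc.2 p q hpq hne ⟨v, hvV⟩ ⟨x, hxV⟩ hv hx.2
      have h2 := BuildingSet.le_of_mem_cluster hx.1
      rw [extendColoring_coe c hvV, extendColoring_coe c hxV] at h2
      exact absurd h2 (not_le.2 h1)
    intro y hy
    obtain ⟨r, hr⟩ := F.exists_node
      (B.subset_ground _ (BuildingSet.cluster_mem hvV) hy)
    exact (F.mem_below p y).2 ⟨r, hmax r ⟨y, Finset.mem_inter.2 ⟨hy, hr⟩⟩, hr⟩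

theorem eq_clusterForest (hF : IsBForest B F) {n : ℕ} {c : {v // v ∈ V} → Fin n}
    (hc : F.StrictlyCompatible c) : F = B.clusterForest (extendColoring c) :=
  RootedForest.ext_of_below (B.cluster (extendColoring c)) (hF.below_eq_cluster hc)
    fun _ _ hv => BuildingSet.clusterForest_below hv

/-- If `c` is strictly compatible with the `B`-forest `F`, then the splitting of `B` along `c`
is `B ∩ F`. -/
theorem induced_eq_split (hF : IsBForest B F) {n : ℕ} {c : {v // v ∈ V} → Fin n}
    (hc : F.StrictlyCompatible c) :
    B.induced F = B.split n (Decomposition.equivColoring V n c) := by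
  set D := Decomposition.equivColoring V n c with hD
  -- On `e` the largest color is that of its maximum node `p`, and within `e` it is attained only on
  -- `p`.
  have key : ∀ e ∈ B.sets, ∀ p : F.Node, (∀ q : F.Node, (e ∩ q.1).Nonempty → F.le q p) →
      ∀ v : {v // v ∈ V}, v.1 ∈ p.1 →
        (∀ j, c v < j → Disjoint e (D.part j)) ∧ e ∩ p.1 = e ∩ D.part (c v) := by
    intro e he p hmax v hv
    have h1 : ∀ w : {v // v ∈ V}, w.1 ∈ e → c w ≤ c v ∧ (c w = c v → w.1 ∈ p.1) := by
      intro w hw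
      obtain ⟨q, hq⟩ := F.exists_node w.2
      by_cases hqp : q = p
      · subst hqp
        exact ⟨(hc.1 q w v hq hv).le, fun _ => hq⟩
      · have := hc.2 q p (hmax q ⟨w, Finset.mem_inter.2 ⟨hw, hq⟩⟩) hqp w v hq hv
        exact ⟨this.le, fun h => absurd h this.ne⟩
    refine ⟨fun j hj => Finset.disjoint_left.2 fun x hx hxj => ?_, ?_⟩
    · have := (Decomposition.mem_part_equivColoring c j ⟨x, D.part_subset j hxj⟩).1 hxj
      exact absurd (h1 ⟨x, D.part_subset j hxj⟩ hx).1 (not_le.2 (hj.trans_eq this.symm))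
    · ext x
      simp only [Finset.mem_inter]
      refine and_congr_right fun hx => ?_
      have hxV := B.subset_ground e he hx
      rw [hD, Decomposition.mem_part_equivColoring c (c v) ⟨x, hxV⟩]
      exact ⟨fun h => hc.1 p ⟨x, hxV⟩ v h hv, fun h => (h1 ⟨x, hxV⟩ hx).2 h⟩
  ext s
  rw [BuildingSet.mem_split, BuildingSet.mem_induced]
  constructor
  · rintro ⟨-, e, he, p, hne, hmax, rfl⟩
    obtain ⟨v, hv⟩ := id hne
    rw [Finset.mem_inter] at hv
    obtain ⟨h1, h2⟩ := key e he p hmax ⟨v, F.node_subset p hv.2⟩ hv.2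
    exact ⟨e, he, _, h2 ▸ hne, h1, h2⟩
  · rintro ⟨e, he, i, ⟨x, hx⟩, hlt, rfl⟩
    obtain ⟨p, hne, hmax⟩ := hF.exists_max_node he
    obtain ⟨v, hv⟩ := id hne
    rw [Finset.mem_inter] at hx hv
    have hvV := F.node_subset p hv.2
    obtain ⟨h1, h2⟩ := key e he p hmax ⟨v, hvV⟩ hv.2
    obtain rfl : c ⟨v, hvV⟩ = i := by
      rcases lt_trichotomy (c ⟨v, hvV⟩) i with h | h | h
      · exact absurd hx.2 (Finset.disjoint_left.1 (h1 i h) hx.1)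
      · exact h
      · exact absurd ((Decomposition.mem_part_equivColoring c _ ⟨v, hvV⟩).2 rfl)
          (Finset.disjoint_left.1 (hlt _ h) hv.1)
    exact ⟨Finset.inter_subset_left.trans (B.subset_ground e he), e, he, p, hne, hmax, h2.symm⟩

/-- Every `e ∩ p` lies in a node, and a node `p` is itself connected, being `F_{≤ p} ∩ p`. -/
theorem components_induced (hF : IsBForest B F) : (B.induced F).components = F.nodes.parts := by
  have hsub : ∀ s ∈ (B.induced F).sets, ∃ p : F.Node, s ⊆ p.1 := by
    intro s hs
    obtain ⟨-, e, -, p, -, -, rfl⟩ := BuildingSet.mem_induced.1 hs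
    exact ⟨p, Finset.inter_subset_right⟩
  have hmem : ∀ p : F.Node, p.1 ∈ (B.induced F).sets := by
    intro p
    have h := Finset.inter_eq_right.2 (F.subset_below p)
    refine BuildingSet.mem_induced.2 ⟨F.node_subset p, F.below p, hF.node p, p,
      h.symm ▸ F.node_nonempty p, ?_, h.symm⟩
    rintro q ⟨x, hx⟩
    rw [Finset.mem_inter] at hx
    obtain ⟨r, hr, hxr⟩ := (F.mem_below p x).1 hx.1
    rwa [F.node_eq hx.2 hxr]
  ext s
  rw [BuildingSet.mem_components]
  constructor
  · rintro ⟨hs, hmax⟩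
    obtain ⟨p, hp⟩ := hsub s hs
    exact hmax p.1 (hmem p) hp ▸ p.2
  · intro hs
    refine ⟨hmem ⟨s, hs⟩, fun e he hse => ?_⟩
    obtain ⟨q, hq⟩ := hsub e he
    obtain ⟨x, hx⟩ := F.node_nonempty ⟨s, hs⟩
    obtain rfl : (⟨s, hs⟩ : F.Node) = q := F.node_eq hx (hq (hse hx))
    exact hq.antisymm hse

end IsBForest

/-! ## Counting compatible colorings -/

namespace RootedForest

variable {α : Type u} [DecidableEq α] {V : Finset α}

/-- The node of a vertex. -/
noncomputable def nodeOf (F : RootedForest V) (v : {v // v ∈ V}) : F.Node :=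
  (F.exists_node v.2).choose

theorem mem_nodeOf (F : RootedForest V) (v : {v // v ∈ V}) : v.1 ∈ (F.nodeOf v).1 :=
  (F.exists_node v.2).choose_spec

theorem nodeOf_eq (F : RootedForest V) {p : F.Node} {v : {v // v ∈ V}} (hv : v.1 ∈ p.1) :
    F.nodeOf v = p :=
  F.node_eq (F.mem_nodeOf v) hv

/-- Colorings constant on nodes are functions on the set of nodes. -/
noncomputable def coloringEquiv (F : RootedForest V) {n : ℕ} (R : Fin n → Fin n → Prop) :
    {c : {v // v ∈ V} → Fin n //
      (∀ (p : F.Node) (v w : {v // v ∈ V}), v.1 ∈ p.1 → w.1 ∈ p.1 → c v = c w) ∧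
      ∀ p q : F.Node, F.le p q → p ≠ q →
        ∀ v w : {v // v ∈ V}, v.1 ∈ p.1 → w.1 ∈ q.1 → R (c v) (c w)} ≃
      {f : F.Node → Fin n // ∀ p q, F.le p q → p ≠ q → R (f p) (f q)} where
  toFun c := ⟨fun p => c.1 ⟨_, F.node_subset p (F.node_nonempty p).choose_spec⟩,
    fun p q hpq hne => c.2.2 p q hpq hne _ _ (F.node_nonempty p).choose_spec
      (F.node_nonempty q).choose_spec⟩
  invFun f := ⟨fun v => f.1 (F.nodeOf v), fun p v w hv hw => by
      simp only [F.nodeOf_eq hv, F.nodeOf_eq hw], fun p q hpq hne v w hv hw => by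
      simp only [F.nodeOf_eq hv, F.nodeOf_eq hw]
      exact f.2 p q hpq hne⟩
  left_inv c := Subtype.ext (funext fun v => c.2.1 (F.nodeOf v) _ _
    (F.node_nonempty _).choose_spec (F.mem_nodeOf v))
  right_inv f := Subtype.ext (funext fun p => congrArg f.1
    (F.nodeOf_eq (F.node_nonempty p).choose_spec))

theorem card_strictlyCompatible (F : RootedForest V) (n : ℕ) :
    Nat.card {c : {v // v ∈ V} → Fin n // F.StrictlyCompatible c} =
      Nat.card {f : F.OrderedNode → Fin n // StrictMono f} :=
  (Nat.card_congr (F.coloringEquiv (· < ·))).trans <|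
    Nat.card_congr <| Equiv.subtypeEquiv (Equiv.refl (F.OrderedNode → Fin n)) fun _ =>
      ⟨fun h p q hpq => h p q hpq.le hpq.ne, fun h _ _ hpq hne => h (lt_of_le_of_ne hpq hne)⟩

theorem card_compatible (F : RootedForest V) (n : ℕ) :
    Nat.card {c : {v // v ∈ V} → Fin n // F.Compatible c} =
      Nat.card {f : F.OrderedNode → Fin n // Monotone f} :=
  (Nat.card_congr (F.coloringEquiv (· ≤ ·))).trans <|
    Nat.card_congr <| Equiv.subtypeEquiv (Equiv.refl (F.OrderedNode → Fin n)) fun f =>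
      ⟨fun h p q hpq => (eq_or_ne p q).elim (fun h' => (congrArg f h').le) (h p q hpq),
        fun h _ _ hpq _ => h hpq⟩

/-- Reciprocity for the poset of nodes, carried from `ℚ` to `K`. -/
theorem exists_polynomial (K : Type v) [Field K] [CharZero K] (F : RootedForest V) :
    ∃ P : Polynomial K,
      (∀ n : ℕ, P.eval (n : K) =
        Nat.card {c : {v // v ∈ V} → Fin n // F.StrictlyCompatible c}) ∧
      ∀ n : ℕ, P.eval (-(n : K)) = (-1) ^ F.nodes.parts.card *
        Nat.card {c : {v // v ∈ V} → Fin n // F.Compatible c} := by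
  obtain ⟨q, hq, hq'⟩ := OrderPolynomial.exists_polynomial F.OrderedNode
  have hcard : Nat.card F.OrderedNode = F.nodes.parts.card :=
    Nat.card_eq_card_toFinset _ |>.trans (by simp)
  refine ⟨q.map (algebraMap ℚ K), fun n => ?_, fun n => ?_⟩
  · have h := congrArg (algebraMap ℚ K) (hq n)
    rw [← Polynomial.eval₂_at_apply, ← Polynomial.eval_map] at h
    rw [card_strictlyCompatible]
    simpa using h
  · have h := congrArg (algebraMap ℚ K) (hq' n)
    rw [← Polynomial.eval₂_at_apply, ← Polynomial.eval_map, hcard] at h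
    rw [card_compatible]
    simpa using h

end RootedForest

/-! ### Summation over forests and the final count -/

namespace BSCharacter

variable {K : Type v} [Field K] {α : Type u} [DecidableEq α]

theorem chi_single_eq_sum (ζ : BSCharacter K α) {V : Finset α} (B : BuildingSet V) (n : ℕ) :
    ζ.chi V (Finsupp.single B 1) n = ∑ F : BForest B, ζ.val (B.induced F.1) *
      (Nat.card {c : {v // v ∈ V} → Fin n // F.1.StrictlyCompatible c} : K) := by
  classical
  have h : ∀ F : BForest B, ζ.val (B.induced F.1) *
      (Nat.card {c : {v // v ∈ V} → Fin n // F.1.StrictlyCompatible c} : K) =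
      ∑ c : {v // v ∈ V} → Fin n, if F.1.StrictlyCompatible c then ζ.val (B.induced F.1) else 0 := by
    intro F
    rw [← Finset.sum_filter, Finset.sum_const, nsmul_eq_mul, mul_comm, Nat.card_eq_fintype_card,
      Fintype.card_subtype]
  rw [chi_single, ← (Decomposition.equivColoring V n).sum_comp, Finset.sum_congr rfl fun F _ => h F,
    Finset.sum_comm]
  refine Finset.sum_congr rfl fun c _ => ?_
  have hc := BuildingSet.strictlyCompatible_clusterForest (B := B) c
  rw [← BuildingSet.isBForest_clusterForest.induced_eq_split hc]
  -- After exchanging the sums, the inner sum for a fixed coloring has a single nonzero candidate,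
  -- its forest of clusters.
  let F₀ : BForest B := ⟨_, BuildingSet.isBForest_clusterForest (C := extendColoring c)⟩
  have hne : ∀ F : BForest B, F ≠ F₀ →
      (if F.1.StrictlyCompatible c then ζ.val (B.induced F.1) else 0) = 0 := fun F hF =>
    if_neg fun h => hF (Subtype.ext (F.2.eq_clusterForest h))
  exact ((Fintype.sum_eq_single F₀ hne).trans (if_pos hc)).symm

/-- Counting pairs of a `ζ`-`B`-forest and a coloring. -/
theorem sum_val_mul_card {ζ : BSCharacter K α} (hζ : ζ.IsCharacteristic) {V : Finset α}
    (B : BuildingSet V) {T : Type*} [Finite T] (R : RootedForest V → T → Prop) :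
    ∑ F : BForest B, ζ.val (B.induced F.1) * (Nat.card {c : T // R F.1 c} : K) =
      (Nat.card {x : BForest B × T // ζ.val (B.induced x.1.1) ≠ 0 ∧ R x.1.1 x.2} : K) := by
  classical
  have := Fintype.ofFinite T
  rw [Nat.card_eq_fintype_card, Fintype.card_subtype, Finset.card_filter, Fintype.sum_prod_type]
  push_cast
  refine Finset.sum_congr rfl fun F _ => ?_
  rw [Nat.card_eq_fintype_card, Fintype.card_subtype, Finset.card_filter]
  rcases hζ V (B.induced F.1) with h | h <;> simp [h]

end BSCharacter

/-- A nonzero value of `ζ` forces every node to have odd size, so `|V|` and the number of nodes have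
the same parity. -/
theorem neg_one_pow_card_mul_neg_one_pow_cc {K : Type v} [Field K] {α : Type u} [DecidableEq α]
    {ζ : BSCharacter K α} (hζ : ζ.IsOdd) {V : Finset α} {B : BuildingSet V}
    {F : RootedForest V} (hF : IsBForest B F) (h : ζ.val (B.induced F) ≠ 0) :
    (-1 : K) ^ V.card * (-1) ^ (B.induced F).cc = 1 := by
  have hodd : ∀ e ∈ F.nodes.parts, Odd e.card := by
    intro e he
    rw [← hF.components_induced] at he
    by_contra hne
    exact h (hζ V _ ⟨e, he, Nat.not_odd_iff_even.1 hne⟩)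
  have h1 : (-1 : K) ^ V.card = (-1) ^ (B.induced F).cc := by
    rw [← F.nodes.sum_card_parts, ← Finset.prod_pow_eq_pow_sum, BuildingSet.cc,
      hF.components_induced]
    exact (Finset.prod_congr rfl fun e he => (hodd e he).neg_one_pow).trans (by simp)
  rw [h1, ← mul_pow]
  simp

theorem mainTheorem8 {K : Type v} [Field K] [CharZero K] {α : Type u} [DecidableEq α]
    (ζ : BSCharacter K α) (V : Finset α) (B : BuildingSet V) :
    -- values at non-negative integers
    (∀ n : ℕ, ζ.chi V (Finsupp.single B 1) n =
      ∑ F : BForest B, ζ.val (B.induced F.1) *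
        (Nat.card {c : {v // v ∈ V} → Fin n // F.1.StrictlyCompatible c} : K)) ∧
    (ζ.IsCharacteristic → ∀ n : ℕ, ζ.chi V (Finsupp.single B 1) n =
      (Nat.card {x : BForest B × ({v // v ∈ V} → Fin n) //
        ζ.val (B.induced x.1.1) ≠ 0 ∧ x.1.1.StrictlyCompatible x.2} : K)) ∧
    -- `P` is the polynomial `χ^ζ_V(B)`; its values at non-positive integers
    ∃ P : Polynomial K,
      (∀ n : ℕ, P.eval (n : K) = ζ.chi V (Finsupp.single B 1) n) ∧
      (∀ n : ℕ, P.eval (-(n : K)) =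
        ∑ F : BForest B, (-1) ^ (B.induced F.1).cc * ζ.val (B.induced F.1) *
          (Nat.card {c : {v // v ∈ V} → Fin n // F.1.Compatible c} : K)) ∧
      (ζ.IsCharacteristic → ζ.IsOdd →
        (∀ n : ℕ, (-1) ^ V.card * P.eval (-(n : K)) =
          (Nat.card {x : BForest B × ({v // v ∈ V} → Fin n) //
            ζ.val (B.induced x.1.1) ≠ 0 ∧ x.1.1.Compatible x.2} : K)) ∧
        (-1) ^ V.card * P.eval (-1 : K) =
          (Nat.card {F : BForest B // ζ.val (B.induced F.1) ≠ 0} : K)) := by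
  refine ⟨ζ.chi_single_eq_sum B, fun hζ n => ?_, ?_⟩
  · rw [ζ.chi_single_eq_sum B, BSCharacter.sum_val_mul_card hζ B
      (fun F c => F.StrictlyCompatible c)]
  choose P hP hP' using fun F : BForest B => F.1.exists_polynomial K
  have hneg : ∀ n : ℕ, (∑ F : BForest B, Polynomial.C (ζ.val (B.induced F.1)) * P F).eval
      (-(n : K)) = ∑ F : BForest B, (-1) ^ (B.induced F.1).cc * ζ.val (B.induced F.1) *
        (Nat.card {c : {v // v ∈ V} → Fin n // F.1.Compatible c} : K) := by
    intro n
    rw [Polynomial.eval_finsetSum]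
    refine Finset.sum_congr rfl fun F _ => ?_
    rw [Polynomial.eval_mul, Polynomial.eval_C, hP', BuildingSet.cc, F.2.components_induced]
    ring
  refine ⟨∑ F : BForest B, Polynomial.C (ζ.val (B.induced F.1)) * P F, fun n => ?_, hneg,
    fun hζ hodd => ?_⟩
  · rw [ζ.chi_single_eq_sum B, Polynomial.eval_finsetSum]
    exact Finset.sum_congr rfl fun F _ => by rw [Polynomial.eval_mul, Polynomial.eval_C, hP]
  have hcount : ∀ n : ℕ, (-1) ^ V.card *
      (∑ F : BForest B, Polynomial.C (ζ.val (B.induced F.1)) * P F).eval (-(n : K)) =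
        (Nat.card {x : BForest B × ({v // v ∈ V} → Fin n) //
          ζ.val (B.induced x.1.1) ≠ 0 ∧ x.1.1.Compatible x.2} : K) := by
    intro n
    rw [hneg, ← BSCharacter.sum_val_mul_card hζ B (fun F c => F.Compatible c), Finset.mul_sum]
    refine Finset.sum_congr rfl fun F _ => ?_
    by_cases h : ζ.val (B.induced F.1) = 0
    · simp [h]
    · rw [← mul_assoc, ← mul_assoc, neg_one_pow_card_mul_neg_one_pow_cc hodd F.2 h, one_mul]
  refine ⟨hcount, ?_⟩
  have h1 := hcount 1
  rw [Nat.cast_one] at h1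
  rw [h1]
  congr 1
  -- With one color there is a single coloring, and it is compatible with every forest.
  have hcomp : ∀ (F : RootedForest V) (c : {v // v ∈ V} → Fin 1), F.Compatible c := fun F c =>
    ⟨fun _ _ _ _ _ => Subsingleton.elim _ _, fun _ _ _ _ _ _ _ _ => (Subsingleton.elim _ _).le⟩
  exact Nat.card_congr
    { toFun := fun x => ⟨x.1.1, x.2.1⟩
      invFun := fun F => ⟨(F.1, fun _ => 0), F.2, hcomp _ _⟩
      left_inv := fun x => Subtype.ext (Prod.ext rfl (Subsingleton.elim _ _))
      right_inv := fun _ => rfl }
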